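/- Let $S$ be a fixed unit sphere in Euclidean space $\mathbb{R}^3$. There do not exist thirteen unit spheres in $\mathbb{R}^3$, no two of which overlap (that is, the open balls bounded by them are pairwise disjoint; the spheres may touch one another), that all touch $S$ from outside (that is, each of them has a common point with $S$, while the open ball bounded by it is disjoint from the open ball bounded by $S$). Moreover, the kissing number in dimension $3$ equals $12$: the largest $n$ for which there exist $n$ pairwise non-overlapping unit spheres that all touch $S$ from outside is exactly $12$. -/

import Mathlib

/-- Euclidean 3-space. -/
abbrev E3 : Type := EuclideanSpace ℝ (Fin 3)

/-- The unit spheres with centers `p` and `q` touch from outside: they have a common point, while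
the open unit balls that they bound are disjoint. -/
def UnitSpheresTouch (p q : E3) : Prop :=
  (Metric.sphere p 1 ∩ Metric.sphere q 1).Nonempty ∧
    Disjoint (Metric.ball p 1) (Metric.ball q 1)

/-- The unit spheres with centers `c i` all touch the unit sphere with center `o` from outside, and
no two of them overlap (they may touch one another). -/
def IsKissingConfiguration (o : E3) {n : ℕ} (c : Fin n → E3) : Prop :=
  (∀ i, UnitSpheresTouch o (c i)) ∧
    Pairwise fun i j => Disjoint (Metric.ball (c i) 1) (Metric.ball (c j) 1)

/-! The upper bound is a Delsarte linear programming argument, strengthened by a count of nearly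
antipodal points. Halving the vectors from the center of `S` to the other centers gives unit vectors
with mutual inner products at most `1/2`. Let f be `kissingPolynomial`, a combination of Legendre
polynomials with nonnegative coefficients and constant term `1`. Each Legendre kernel is positive
semidefinite on the sphere, so for thirteen points the double sum of f over inner products is at
least `13²`.

From above, fix one point. Its diagonal term is `f 1 = 10.4337`. Since f ≤ 0 on `[-0.7072, 1/2]`,
only the points in the opposite cap can contribute positively, and moment inequalities for the
points of that cap bound their contribution by `2.56625` (`sum_kissingPolynomial_neg_le`). Each row
is then at most `12.99995 < 13`, a contradiction. Twelve is attained by the face-centered cubic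
lattice. -/

/-! ### Addition formulas for Legendre polynomials -/

/-- `rePow A B n` is the real part of `z ^ n` for a complex `z` with real part `A` and `‖z‖² = B`. -/
def rePow (A B : ℝ) : ℕ → ℝ
  | 0 => 1
  | 1 => A
  | n + 2 => 2 * A * rePow A B (n + 1) - B * rePow A B n

theorem re_pow_eq_rePow (z : ℂ) (n : ℕ) : (z ^ n).re = rePow z.re (Complex.normSq z) n := by
  induction n using Nat.twoStepInduction with
  | zero => simp [rePow]
  | one => simp [rePow]
  | more n h0 h1 =>
    rw [rePow, ← h0, ← h1, Complex.normSq_apply]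
    simp only [pow_succ, Complex.mul_re, Complex.mul_im]
    ring

/-- The Legendre polynomial of degree `2`. -/
noncomputable def legendreP2 (t : ℝ) : ℝ := 3/2 * t ^ 2 - 1/2

/-- The Legendre polynomial of degree `3`. -/
noncomputable def legendreP3 (t : ℝ) : ℝ := 5/2 * t ^ 3 - 3/2 * t

/-- The Legendre polynomial of degree `4`. -/
noncomputable def legendreP4 (t : ℝ) : ℝ := 35/8 * t ^ 4 - 15/4 * t ^ 2 + 3/8

/-- The Legendre polynomial of degree `9`. -/
noncomputable def legendreP9 (t : ℝ) : ℝ := 12155/128 * t ^ 9 - 6435/32 * t ^ 7 + 9009/64 * t ^ 5 - 1155/32 * t ^ 3 + 315/128 * t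

/-- This and its analogues are the addition theorem for spherical harmonics: `a`, `b` are the
heights of two unit vectors and `A` is the inner product of their plane parts. Through `rePow` it
becomes a polynomial identity, and all coefficients are positive. -/
theorem legendreP2_addition (a b A : ℝ) :
    legendreP2 (a * b + A) =
      1/4 * ((3 * a ^ 2 - 1) * (3 * b ^ 2 - 1) * rePow A ((1 - a ^ 2) * (1 - b ^ 2)) 0) +
      3 * (a * b * rePow A ((1 - a ^ 2) * (1 - b ^ 2)) 1) +
      3/4 * rePow A ((1 - a ^ 2) * (1 - b ^ 2)) 2 := by
  simp only [legendreP2, rePow]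
  ring

theorem legendreP3_addition (a b A : ℝ) :
    legendreP3 (a * b + A) =
      1/4 * ((5 * a ^ 3 - 3 * a) * (5 * b ^ 3 - 3 * b) * rePow A ((1 - a ^ 2) * (1 - b ^ 2)) 0) +
      3/8 * ((5 * a ^ 2 - 1) * (5 * b ^ 2 - 1) * rePow A ((1 - a ^ 2) * (1 - b ^ 2)) 1) +
      15/4 * (a * b * rePow A ((1 - a ^ 2) * (1 - b ^ 2)) 2) +
      5/8 * rePow A ((1 - a ^ 2) * (1 - b ^ 2)) 3 := by
  simp only [legendreP3, rePow]
  ring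

theorem legendreP4_addition (a b A : ℝ) :
    legendreP4 (a * b + A) =
      1/64 * ((35 * a ^ 4 - 30 * a ^ 2 + 3) * (35 * b ^ 4 - 30 * b ^ 2 + 3) * rePow A ((1 - a ^ 2) * (1 - b ^ 2)) 0) +
      5/8 * ((7 * a ^ 3 - 3 * a) * (7 * b ^ 3 - 3 * b) * rePow A ((1 - a ^ 2) * (1 - b ^ 2)) 1) +
      5/16 * ((7 * a ^ 2 - 1) * (7 * b ^ 2 - 1) * rePow A ((1 - a ^ 2) * (1 - b ^ 2)) 2) +
      35/8 * (a * b * rePow A ((1 - a ^ 2) * (1 - b ^ 2)) 3) +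
      35/64 * rePow A ((1 - a ^ 2) * (1 - b ^ 2)) 4 := by
  simp only [legendreP4, rePow]
  ring

theorem legendreP9_addition (a b A : ℝ) :
    legendreP9 (a * b + A) =
      1/16384 * ((12155 * a ^ 9 - 25740 * a ^ 7 + 18018 * a ^ 5 - 4620 * a ^ 3 + 315 * a) * (12155 * b ^ 9 - 25740 * b ^ 7 + 18018 * b ^ 5 - 4620 * b ^ 3 + 315 * b) * rePow A ((1 - a ^ 2) * (1 - b ^ 2)) 0) +
      45/16384 * ((2431 * a ^ 8 - 4004 * a ^ 6 + 2002 * a ^ 4 - 308 * a ^ 2 + 7) * (2431 * b ^ 8 - 4004 * b ^ 6 + 2002 * b ^ 4 - 308 * b ^ 2 + 7) * rePow A ((1 - a ^ 2) * (1 - b ^ 2)) 1) +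
      495/2048 * ((221 * a ^ 7 - 273 * a ^ 5 + 91 * a ^ 3 - 7 * a) * (221 * b ^ 7 - 273 * b ^ 5 + 91 * b ^ 3 - 7 * b) * rePow A ((1 - a ^ 2) * (1 - b ^ 2)) 2) +
      1155/8192 * ((221 * a ^ 6 - 195 * a ^ 4 + 39 * a ^ 2 - 1) * (221 * b ^ 6 - 195 * b ^ 4 + 39 * b ^ 2 - 1) * rePow A ((1 - a ^ 2) * (1 - b ^ 2)) 3) +
      45045/4096 * ((17 * a ^ 5 - 10 * a ^ 3 + a) * (17 * b ^ 5 - 10 * b ^ 3 + b) * rePow A ((1 - a ^ 2) * (1 - b ^ 2)) 4) +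
      1287/8192 * ((85 * a ^ 4 - 30 * a ^ 2 + 1) * (85 * b ^ 4 - 30 * b ^ 2 + 1) * rePow A ((1 - a ^ 2) * (1 - b ^ 2)) 5) +
      2145/2048 * ((17 * a ^ 3 - 3 * a) * (17 * b ^ 3 - 3 * b) * rePow A ((1 - a ^ 2) * (1 - b ^ 2)) 6) +
      6435/32768 * ((17 * a ^ 2 - 1) * (17 * b ^ 2 - 1) * rePow A ((1 - a ^ 2) * (1 - b ^ 2)) 7) +
      109395/16384 * (a * b * rePow A ((1 - a ^ 2) * (1 - b ^ 2)) 8) +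
      12155/32768 * rePow A ((1 - a ^ 2) * (1 - b ^ 2)) 9 := by
  simp only [legendreP9, rePow]
  ring

/-! ### Positive semidefinite kernels on the sphere -/

/-- The projection of a point of space to the complex plane that forgets the last coordinate. -/
def planePart (x : E3) : ℂ := ⟨x 0, x 1⟩

theorem inner_eq_last_add_planePart (x y : E3) :
    inner ℝ x y = x 2 * y 2 + (planePart x * (starRingEnd ℂ) (planePart y)).re := by
  simp only [PiLp.inner_apply, Fin.sum_univ_three, planePart, Complex.mul_re, Complex.conj_re,
    Complex.conj_im, RCLike.inner_apply, conj_trivial]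
  ring

theorem normSq_planePart {x : E3} (hx : ‖x‖ = 1) : Complex.normSq (planePart x) = 1 - x 2 ^ 2 := by
  have h : x 0 ^ 2 + x 1 ^ 2 + x 2 ^ 2 = 1 := by
    have := EuclideanSpace.real_norm_sq_eq x
    rw [hx, Fin.sum_univ_three] at this
    linarith
  simp only [planePart, Complex.normSq_mk]
  linarith

/-- The `m`-th azimuthal kernel of two points of space. -/
noncomputable def azimuthal (m : ℕ) (x y : E3) : ℝ :=
  ((planePart x * (starRingEnd ℂ) (planePart y)) ^ m).re

theorem azimuthal_eq_rePow {x y : E3} (hx : ‖x‖ = 1) (hy : ‖y‖ = 1) (m : ℕ) :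
    azimuthal m x y = rePow (planePart x * (starRingEnd ℂ) (planePart y)).re
      ((1 - x 2 ^ 2) * (1 - y 2 ^ 2)) m := by
  rw [azimuthal, re_pow_eq_rePow, map_mul, Complex.normSq_conj, normSq_planePart hx,
    normSq_planePart hy]

/-- A real kernel on the unit sphere is positive semidefinite. -/
def IsPSDKernel (K : E3 → E3 → ℝ) : Prop :=
  ∀ (n : ℕ) (x : Fin n → E3), (∀ i, ‖x i‖ = 1) → 0 ≤ ∑ i, ∑ j, K (x i) (x j)

theorem IsPSDKernel.congr {K L : E3 → E3 → ℝ} (hK : IsPSDKernel K)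
    (h : ∀ x y, ‖x‖ = 1 → ‖y‖ = 1 → L x y = K x y) : IsPSDKernel L := fun n x hx => by
  simpa only [h _ _ (hx _) (hx _)] using hK n x hx

theorem IsPSDKernel.add {K L : E3 → E3 → ℝ} (hK : IsPSDKernel K) (hL : IsPSDKernel L) :
    IsPSDKernel fun x y => K x y + L x y := fun n x hx => by
  simpa only [Finset.sum_add_distrib] using add_nonneg (hK n x hx) (hL n x hx)

theorem IsPSDKernel.const_mul {K : E3 → E3 → ℝ} (hK : IsPSDKernel K) (c : ℝ)
    (hc : 0 ≤ c) : IsPSDKernel fun x y => c * K x y := fun n x hx => by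
  simpa only [← Finset.mul_sum] using mul_nonneg hc (hK n x hx)

/-- The kernel has rank one over `ℂ`: with z the plane part, the double sum is the squared modulus
of Σ φ(height) zᵐ. -/
theorem isPSDKernel_mul_azimuthal (φ : ℝ → ℝ) (m : ℕ) :
    IsPSDKernel fun x y => φ (x 2) * φ (y 2) * azimuthal m x y := fun n x _ => by
  have h : ∑ i, ∑ j, φ (x i 2) * φ (x j 2) * azimuthal m (x i) (x j) =
      Complex.normSq (∑ i, φ (x i 2) * planePart (x i) ^ m) := by
    rw [← Complex.ofReal_re (Complex.normSq _), ← Complex.mul_conj, map_sum, Finset.sum_mul_sum,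
      Complex.re_sum]
    refine Finset.sum_congr rfl fun i _ => ?_
    rw [Complex.re_sum]
    refine Finset.sum_congr rfl fun j _ => ?_
    rw [azimuthal, ← Complex.re_ofReal_mul, mul_pow]
    simp only [map_mul, map_pow, Complex.conj_ofReal, Complex.ofReal_mul]
    congr 1
    ring
  rw [h]
  exact Complex.normSq_nonneg _

theorem isPSDKernel_azimuthal (m : ℕ) : IsPSDKernel (azimuthal m) := by
  simpa using isPSDKernel_mul_azimuthal (fun _ => 1) m

theorem isPSDKernel_inner : IsPSDKernel fun x y => inner ℝ x y := fun n x _ => by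
  have h : ∑ i, ∑ j, inner ℝ (x i) (x j) = inner ℝ (∑ i, x i) (∑ j, x j) := by
    rw [sum_inner]
    simp only [inner_sum]
  rw [h]
  exact real_inner_self_nonneg

theorem isPSDKernel_legendreP2 : IsPSDKernel fun x y => legendreP2 (inner ℝ x y) := by
  have h := (isPSDKernel_mul_azimuthal
    (fun a => 3 * a ^ 2 - 1) 0).const_mul (1/4) (by norm_num)
  replace h := h.add <| (isPSDKernel_mul_azimuthal
    (fun a => a) 1).const_mul (3) (by norm_num)
  replace h := h.add <| (isPSDKernel_azimuthal 2).const_mul (3/4) (by norm_num)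
  refine h.congr fun x y hx hy => ?_
  rw [inner_eq_last_add_planePart, legendreP2_addition]
  simp only [azimuthal_eq_rePow hx hy]

theorem isPSDKernel_legendreP3 : IsPSDKernel fun x y => legendreP3 (inner ℝ x y) := by
  have h := (isPSDKernel_mul_azimuthal
    (fun a => 5 * a ^ 3 - 3 * a) 0).const_mul (1/4) (by norm_num)
  replace h := h.add <| (isPSDKernel_mul_azimuthal
    (fun a => 5 * a ^ 2 - 1) 1).const_mul (3/8) (by norm_num)
  replace h := h.add <| (isPSDKernel_mul_azimuthal
    (fun a => a) 2).const_mul (15/4) (by norm_num)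
  replace h := h.add <| (isPSDKernel_azimuthal 3).const_mul (5/8) (by norm_num)
  refine h.congr fun x y hx hy => ?_
  rw [inner_eq_last_add_planePart, legendreP3_addition]
  simp only [azimuthal_eq_rePow hx hy]

theorem isPSDKernel_legendreP4 : IsPSDKernel fun x y => legendreP4 (inner ℝ x y) := by
  have h := (isPSDKernel_mul_azimuthal
    (fun a => 35 * a ^ 4 - 30 * a ^ 2 + 3) 0).const_mul (1/64) (by norm_num)
  replace h := h.add <| (isPSDKernel_mul_azimuthal
    (fun a => 7 * a ^ 3 - 3 * a) 1).const_mul (5/8) (by norm_num)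
  replace h := h.add <| (isPSDKernel_mul_azimuthal
    (fun a => 7 * a ^ 2 - 1) 2).const_mul (5/16) (by norm_num)
  replace h := h.add <| (isPSDKernel_mul_azimuthal
    (fun a => a) 3).const_mul (35/8) (by norm_num)
  replace h := h.add <| (isPSDKernel_azimuthal 4).const_mul (35/64) (by norm_num)
  refine h.congr fun x y hx hy => ?_
  rw [inner_eq_last_add_planePart, legendreP4_addition]
  simp only [azimuthal_eq_rePow hx hy]

theorem isPSDKernel_legendreP9 : IsPSDKernel fun x y => legendreP9 (inner ℝ x y) := by
  have h := (isPSDKernel_mul_azimuthal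
    (fun a => 12155 * a ^ 9 - 25740 * a ^ 7 + 18018 * a ^ 5 - 4620 * a ^ 3 + 315 * a) 0).const_mul (1/16384) (by norm_num)
  replace h := h.add <| (isPSDKernel_mul_azimuthal
    (fun a => 2431 * a ^ 8 - 4004 * a ^ 6 + 2002 * a ^ 4 - 308 * a ^ 2 + 7) 1).const_mul (45/16384) (by norm_num)
  replace h := h.add <| (isPSDKernel_mul_azimuthal
    (fun a => 221 * a ^ 7 - 273 * a ^ 5 + 91 * a ^ 3 - 7 * a) 2).const_mul (495/2048) (by norm_num)
  replace h := h.add <| (isPSDKernel_mul_azimuthal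
    (fun a => 221 * a ^ 6 - 195 * a ^ 4 + 39 * a ^ 2 - 1) 3).const_mul (1155/8192) (by norm_num)
  replace h := h.add <| (isPSDKernel_mul_azimuthal
    (fun a => 17 * a ^ 5 - 10 * a ^ 3 + a) 4).const_mul (45045/4096) (by norm_num)
  replace h := h.add <| (isPSDKernel_mul_azimuthal
    (fun a => 85 * a ^ 4 - 30 * a ^ 2 + 1) 5).const_mul (1287/8192) (by norm_num)
  replace h := h.add <| (isPSDKernel_mul_azimuthal
    (fun a => 17 * a ^ 3 - 3 * a) 6).const_mul (2145/2048) (by norm_num)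
  replace h := h.add <| (isPSDKernel_mul_azimuthal
    (fun a => 17 * a ^ 2 - 1) 7).const_mul (6435/32768) (by norm_num)
  replace h := h.add <| (isPSDKernel_mul_azimuthal
    (fun a => a) 8).const_mul (109395/16384) (by norm_num)
  replace h := h.add <| (isPSDKernel_azimuthal 9).const_mul (12155/32768) (by norm_num)
  refine h.congr fun x y hx hy => ?_
  rw [inner_eq_last_add_planePart, legendreP9_addition]
  simp only [azimuthal_eq_rePow hx hy]

/-! ### Estimates for the test polynomial -/

/-- The Legendre expansion that is used for the linear programming bound. -/
noncomputable def kissingPolynomial (x : ℝ) : ℝ :=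
  1 + 1.7736 * x + 3.5057 * legendreP2 x + 1.737 * legendreP3 x + 1.993 * legendreP4 x +
    0.4244 * legendreP9 x

/-- Here and below, a polynomial is written in the Bernstein basis of an interval, with `u`, `v` the
distances to its endpoints and an integer factor clearing denominators. The intervals are cut so
that all coefficients come out positive. -/
theorem kissingPolynomial_nonpos_left {x : ℝ} (ha : -(442 / 625) ≤ x) (hb : x ≤ -(41 / 100)) :
    kissingPolynomial x ≤ 0 := by
  obtain ⟨u, hu⟩ : ∃ u, u = x + (442 / 625) := ⟨_, rfl⟩
  obtain ⟨v, hv⟩ : ∃ v, v = -(41 / 100) - x := ⟨_, rfl⟩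
  have hu0 : 0 ≤ u := by linarith
  have hv0 : 0 ≤ v := by linarith
  have h : 4416510810621327608083401152000 * (0 - kissingPolynomial x) =
      297062936473547171255303458521088 * v ^ 9 +
      204701302328990641203995600386457600 * u * v ^ 8 +
      1096161919129587727599957738373120000 * u ^ 2 * v ^ 7 +
      2354277131186845610778622537984000000 * u ^ 3 * v ^ 6 +
      2616459905490712678367619652800000000 * u ^ 4 * v ^ 5 +
      1596718121738623377258016965000000000 * u ^ 5 * v ^ 4 +
      510834877762385669015039875000000000 * u ^ 6 * v ^ 3 +
      69081596622076671754500390625000000 * u ^ 7 * v ^ 2 +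
      1509573300522138728856201171875000 * u ^ 8 * v +
      307195077751111532787322998046875 * u ^ 9 := by
    simp only [hu, hv, kissingPolynomial, legendreP2, legendreP3, legendreP4, legendreP9]
    ring
  have h0 : 0 ≤ 4416510810621327608083401152000 * (0 - kissingPolynomial x) := by
    rw [h]
    positivity
  linarith

theorem kissingPolynomial_nonpos_middle {x : ℝ} (ha : -(41 / 100) ≤ x) (hb : x ≤ (1 / 25)) :
    kissingPolynomial x ≤ 0 := by
  obtain ⟨u, hu⟩ : ∃ u, u = x + (41 / 100) := ⟨_, rfl⟩
  obtain ⟨v, hv⟩ : ∃ v, v = (1 / 25) - x := ⟨_, rfl⟩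
  have hu0 : 0 ≤ u := by linarith
  have hv0 : 0 ≤ v := by linarith
  have h : 16142520375000000000 * (0 - kissingPolynomial x) =
      26843115487329127217 * v ^ 9 +
      407657286458208561468 * u * v ^ 8 +
      15930176806488551327232 * u ^ 2 * v ^ 7 +
      89088003173215547509248 * u ^ 3 * v ^ 6 +
      190319520321138195935232 * u ^ 4 * v ^ 5 +
      186274796784103633723392 * u ^ 5 * v ^ 4 +
      84623713185411759341568 * u ^ 6 * v ^ 3 +
      14544666453432966316032 * u ^ 7 * v ^ 2 +
      90876022328339202048 * u ^ 8 * v +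
      25439229885160620032 * u ^ 9 := by
    simp only [hu, hv, kissingPolynomial, legendreP2, legendreP3, legendreP4, legendreP9]
    ring
  have h0 : 0 ≤ 16142520375000000000 * (0 - kissingPolynomial x) := by
    rw [h]
    positivity
  linarith

theorem kissingPolynomial_nonpos_right {x : ℝ} (ha : (1 / 25) ≤ x) (hb : x ≤ (1 / 2)) :
    kissingPolynomial x ≤ 0 := by
  obtain ⟨u, hu⟩ : ∃ u, u = x - (1 / 25) := ⟨_, rfl⟩
  obtain ⟨v, hv⟩ : ∃ v, v = (1 / 2) - x := ⟨_, rfl⟩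
  have hu0 : 0 ≤ u := by linarith
  have hv0 : 0 ≤ v := by linarith
  have h : 115273770333632000 * (0 - kissingPolynomial x) =
      149057987608363008 * v ^ 9 +
      2168545865734758400 * u * v ^ 8 +
      102190681238938880000 * u ^ 2 * v ^ 7 +
      772166347316960000000 * u ^ 3 * v ^ 6 +
      2475045459072780000000 * u ^ 4 * v ^ 5 +
      4089932958915000000000 * u ^ 5 * v ^ 4 +
      3612891623234375000000 * u ^ 6 * v ^ 3 +
      1602916123203125000000 * u ^ 7 * v ^ 2 +
      281696314514160156250 * u ^ 8 * v +
      143463897705078125 * u ^ 9 := by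
    simp only [hu, hv, kissingPolynomial, legendreP2, legendreP3, legendreP4, legendreP9]
    ring
  have h0 : 0 ≤ 115273770333632000 * (0 - kissingPolynomial x) := by
    rw [h]
    positivity
  linarith

theorem kissingPolynomial_neg_le_quadratic_left {x : ℝ} (ha : (442 / 625) ≤ x) (hb : x ≤ (91 / 100)) :
    kissingPolynomial (-x) ≤ (18.84 * (x - 0.7072) ^ 2 + 5.036 * (x - 0.7072)) := by
  obtain ⟨u, hu⟩ : ∃ u, u = x - (442 / 625) := ⟨_, rfl⟩
  obtain ⟨v, hv⟩ : ∃ v, v = (91 / 100) - x := ⟨_, rfl⟩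
  have hu0 : 0 ≤ u := by linarith
  have hv0 : 0 ≤ v := by linarith
  have h : 141661425602264151613318848000 * ((18.84 * (x - 0.7072) ^ 2 + 5.036 * (x - 0.7072)) - kissingPolynomial (-x)) =
      297062936473547171255303458521088 * v ^ 9 +
      114157163343074226899322199882137600 * u * v ^ 8 +
      844601460672049602065567843205120000 * u ^ 2 * v ^ 7 +
      2617538927531274368852673571584000000 * u ^ 3 * v ^ 6 +
      4342262875173829215378815812800000000 * u ^ 4 * v ^ 5 +
      4092019897536768616520233215000000000 * u ^ 5 * v ^ 4 +
      2116186867965756343318189875000000000 * u ^ 6 * v ^ 3 +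
      509115789703536465846629296875000000 * u ^ 7 * v ^ 2 +
      30222450280106041435887451171875000 * u ^ 8 * v +
      744648070437682024387359619140625 * u ^ 9 := by
    simp only [hu, hv, kissingPolynomial, legendreP2, legendreP3, legendreP4, legendreP9]
    ring
  have h0 : 0 ≤ 141661425602264151613318848000 * ((18.84 * (x - 0.7072) ^ 2 + 5.036 * (x - 0.7072)) - kissingPolynomial (-x)) := by
    rw [h]
    positivity
  linarith

theorem kissingPolynomial_neg_le_quadratic_middle {x : ℝ} (ha : (91 / 100) ≤ x) (hb : x ≤ (19 / 20)) :
    kissingPolynomial (-x) ≤ (18.84 * (x - 0.7072) ^ 2 + 5.036 * (x - 0.7072)) := by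
  obtain ⟨u, hu⟩ : ∃ u, u = x - (91 / 100) := ⟨_, rfl⟩
  obtain ⟨v, hv⟩ : ∃ v, v = (19 / 20) - x := ⟨_, rfl⟩
  have hu0 : 0 ≤ u := by linarith
  have hv0 : 0 ≤ v := by linarith
  have h : 16777216000 * ((18.84 * (x - 0.7072) ^ 2 + 5.036 * (x - 0.7072)) - kissingPolynomial (-x)) =
      195205023776815716601 * v ^ 9 +
      540713302307559067405 * u * v ^ 8 +
      298063292740479572900 * u ^ 2 * v ^ 7 +
      4679206656091945954500 * u ^ 3 * v ^ 6 +
      27693513244078938928750 * u ^ 4 * v ^ 5 +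
      65471069583205426793750 * u ^ 5 * v ^ 4 +
      81984312937248853812500 * u ^ 6 * v ^ 3 +
      58020303154044287812500 * u ^ 7 * v ^ 2 +
      22062037839047300390625 * u ^ 8 * v +
      3521839641919314453125 * u ^ 9 := by
    simp only [hu, hv, kissingPolynomial, legendreP2, legendreP3, legendreP4, legendreP9]
    ring
  have h0 : 0 ≤ 16777216000 * ((18.84 * (x - 0.7072) ^ 2 + 5.036 * (x - 0.7072)) - kissingPolynomial (-x)) := by
    rw [h]
    positivity
  linarith

theorem kissingPolynomial_neg_le_quadratic_right {x : ℝ} (ha : (19 / 20) ≤ x) (hb : x ≤ 1) :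
    kissingPolynomial (-x) ≤ (18.84 * (x - 0.7072) ^ 2 + 5.036 * (x - 0.7072)) := by
  obtain ⟨u, hu⟩ : ∃ u, u = x - (19 / 20) := ⟨_, rfl⟩
  obtain ⟨v, hv⟩ : ∃ v, v = 1 - x := ⟨_, rfl⟩
  have hu0 : 0 ≤ u := by linarith
  have hv0 : 0 ≤ v := by linarith
  have h : 64000 * ((18.84 * (x - 0.7072) ^ 2 + 5.036 * (x - 0.7072)) - kissingPolynomial (-x)) =
      1803181896662689 * v ^ 9 +
      22394729190429180 * u * v ^ 8 +
      120891467284185600 * u ^ 2 * v ^ 7 +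
      372910412545907200 * u ^ 3 * v ^ 6 +
      725982120604364800 * u ^ 4 * v ^ 5 +
      927052047231180800 * u ^ 5 * v ^ 4 +
      778032629691187200 * u ^ 6 * v ^ 3 +
      414533598792908800 * u ^ 7 * v ^ 2 +
      127418295595827200 * u ^ 8 * v +
      17236907314380800 * u ^ 9 := by
    simp only [hu, hv, kissingPolynomial, legendreP2, legendreP3, legendreP4, legendreP9]
    ring
  have h0 : 0 ≤ 64000 * ((18.84 * (x - 0.7072) ^ 2 + 5.036 * (x - 0.7072)) - kissingPolynomial (-x)) := by
    rw [h]
    positivity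
  linarith

theorem kissingPolynomial_neg_le_const_left {x : ℝ} (ha : (442 / 625) ≤ x) (hb : x ≤ (99 / 100)) :
    kissingPolynomial (-x) ≤ 2.56625 := by
  obtain ⟨u, hu⟩ : ∃ u, u = x - (442 / 625) := ⟨_, rfl⟩
  obtain ⟨v, hv⟩ : ∃ v, v = (99 / 100) - x := ⟨_, rfl⟩
  have hu0 : 0 ≤ u := by linarith
  have hv0 : 0 ≤ v := by linarith
  have h : 403512189033988890012524864000 * (2.56625 - kissingPolynomial (-x)) =
      89546134548960506738750757636931584 * v ^ 9 +
      778452490448082514372939207971635200 * u * v ^ 8 +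
      2935306537072811771574939511439360000 * u ^ 2 * v ^ 7 +
      6224616907775464315336350672128000000 * u ^ 3 * v ^ 6 +
      8026670117182356880058151726400000000 * u ^ 4 * v ^ 5 +
      6318316022233046924013685505000000000 * u ^ 5 * v ^ 4 +
      2848460989814595344265817125000000000 * u ^ 6 * v ^ 3 +
      604593229494079228821889453125000000 * u ^ 7 * v ^ 2 +
      26343393445635591636544189453125000 * u ^ 8 * v +
      364784228649075264308929443359375 * u ^ 9 := by
    simp only [hu, hv, kissingPolynomial, legendreP2, legendreP3, legendreP4, legendreP9]
    ring
  have h0 : 0 ≤ 403512189033988890012524864000 * (2.56625 - kissingPolynomial (-x)) := by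
    rw [h]
    positivity
  linarith

theorem kissingPolynomial_neg_le_const_right {x : ℝ} (ha : (99 / 100) ≤ x) (hb : x ≤ 1) :
    kissingPolynomial (-x) ≤ 2.56625 := by
  obtain ⟨u, hu⟩ : ∃ u, u = x - (99 / 100) := ⟨_, rfl⟩
  obtain ⟨v, hv⟩ : ∃ v, v = 1 - x := ⟨_, rfl⟩
  have hu0 : 0 ≤ u := by linarith
  have hv0 : 0 ≤ v := by linarith
  have h : 64000 * (2.56625 - kissingPolynomial (-x)) =
      669381977844882302609 * v ^ 9 +
      4528118850134176401900 * u * v ^ 8 +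
      13060992181906259520000 * u ^ 2 * v ^ 7 +
      20922608088227208000000 * u ^ 3 * v ^ 6 +
      20488758486050240000000 * u ^ 4 * v ^ 5 +
      13113227531440000000000 * u ^ 5 * v ^ 4 +
      6229330304000000000000 * u ^ 6 * v ^ 3 +
      2648348480000000000000 * u ^ 7 * v ^ 2 +
      927040000000000000000 * u ^ 8 * v +
      163200000000000000000 * u ^ 9 := by
    simp only [hu, hv, kissingPolynomial, legendreP2, legendreP3, legendreP4, legendreP9]
    ring
  have h0 : 0 ≤ 64000 * (2.56625 - kissingPolynomial (-x)) := by
    rw [h]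
    positivity
  linarith

theorem kissingPolynomial_nonpos {x : ℝ} (ha : -0.7072 ≤ x) (hb : x ≤ 1 / 2) :
    kissingPolynomial x ≤ 0 := by
  rcases le_total x (-(41 / 100)) with h | h
  · exact kissingPolynomial_nonpos_left (by linarith) h
  rcases le_total x (1 / 25) with h' | h'
  · exact kissingPolynomial_nonpos_middle h h'
  · exact kissingPolynomial_nonpos_right h' hb

theorem kissingPolynomial_neg_le_quadratic {x : ℝ} (ha : 0.7072 ≤ x) (hb : x ≤ 1) :
    kissingPolynomial (-x) ≤ 18.84 * (x - 0.7072) ^ 2 + 5.036 * (x - 0.7072) := by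
  rcases le_total x (91 / 100) with h | h
  · exact kissingPolynomial_neg_le_quadratic_left (by linarith) h
  rcases le_total x (19 / 20) with h' | h'
  · exact kissingPolynomial_neg_le_quadratic_middle h h'
  · exact kissingPolynomial_neg_le_quadratic_right h' hb

theorem kissingPolynomial_neg_le_const {x : ℝ} (ha : 0.7072 ≤ x) (hb : x ≤ 1) :
    kissingPolynomial (-x) ≤ 2.56625 := by
  rcases le_total x (99 / 100) with h | h
  · exact kissingPolynomial_neg_le_const_left (by linarith) h
  · exact kissingPolynomial_neg_le_const_right h hb

theorem kissingPolynomial_one : kissingPolynomial 1 = 10.4337 := by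
  norm_num [kissingPolynomial, legendreP2, legendreP3, legendreP4, legendreP9]

/-! ### Moments of the points in a cap -/

/-- A weighted sum of inner products of a unit vector with unit vectors at mutual angles of at least
sixty degrees. -/
theorem sq_sum_weight_mul_inner_le {ι V : Type*} [NormedAddCommGroup V] [InnerProductSpace ℝ V]
    (J : Finset ι) (y : ι → V) (e : V) (he : ‖e‖ = 1) (hy : ∀ i ∈ J, ‖y i‖ = 1)
    (hyy : ∀ i ∈ J, ∀ j ∈ J, i ≠ j → inner ℝ (y i) (y j) ≤ 1 / 2)
    (w : ι → ℝ) (hw : ∀ i ∈ J, 0 ≤ w i) :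
    (∑ i ∈ J, w i * inner ℝ e (y i)) ^ 2 ≤ (∑ i ∈ J, w i ^ 2 + (∑ i ∈ J, w i) ^ 2) / 2 := by
  classical
  have h1 : ∑ i ∈ J, w i * inner ℝ e (y i) = inner ℝ e (∑ i ∈ J, w i • y i) := by
    simp only [inner_sum, real_inner_smul_right]
  have h2 : (inner ℝ e (∑ i ∈ J, w i • y i)) ^ 2 ≤ ‖∑ i ∈ J, w i • y i‖ ^ 2 := by
    rw [sq_le_sq, abs_norm]
    simpa [he] using abs_real_inner_le_norm e (∑ i ∈ J, w i • y i)
  have h3 : ‖∑ i ∈ J, w i • y i‖ ^ 2 = ∑ i ∈ J, ∑ j ∈ J, w i * w j * inner ℝ (y i) (y j) := by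
    rw [← real_inner_self_eq_norm_sq, sum_inner]
    simp only [inner_sum, real_inner_smul_left, real_inner_smul_right]
    exact Finset.sum_congr rfl fun i _ => Finset.sum_congr rfl fun j _ => by ring
  -- Off the diagonal the inner product is at most `1/2`; on it, the value `1` is split as `1/2 +
  -- 1/2`.
  have h4 : ∑ i ∈ J, ∑ j ∈ J, w i * w j * inner ℝ (y i) (y j) ≤
      ∑ i ∈ J, ∑ j ∈ J, (w i * w j / 2 + if i = j then w i ^ 2 / 2 else 0) := by
    refine Finset.sum_le_sum fun i hi => Finset.sum_le_sum fun j hj => ?_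
    by_cases hij : i = j
    · subst hij
      rw [real_inner_self_eq_norm_sq, hy i hi, if_pos rfl]
      linarith
    · rw [if_neg hij]
      nlinarith [hyy i hi j hj hij, mul_nonneg (hw i hi) (hw j hj)]
  have h5 : ∑ i ∈ J, ∑ j ∈ J, (w i * w j / 2 + if i = j then w i ^ 2 / 2 else 0) =
      (∑ i ∈ J, w i ^ 2 + (∑ i ∈ J, w i) ^ 2) / 2 := by
    have : ∀ i ∈ J, ∑ j ∈ J, (w i * w j / 2 + if i = j then w i ^ 2 / 2 else 0) =
        w i * (∑ j ∈ J, w j) / 2 + w i ^ 2 / 2 := fun i hi => by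
      rw [Finset.sum_add_distrib, Finset.sum_ite_eq, if_pos hi, ← Finset.sum_div, Finset.mul_sum]
    rw [Finset.sum_congr rfl this, Finset.sum_add_distrib, ← Finset.sum_div, ← Finset.sum_div,
      ← Finset.sum_mul]
    ring
  rw [h1]
  linarith

/-- Bounds for the first two moments of the excess of the inner products over `0.7072`. -/
theorem moment_bounds {ι V : Type*} [NormedAddCommGroup V] [InnerProductSpace ℝ V]
    (J : Finset ι) (y : ι → V) (e : V) (he : ‖e‖ = 1) (hy : ∀ i ∈ J, ‖y i‖ = 1)
    (hyy : ∀ i ∈ J, ∀ j ∈ J, i ≠ j → inner ℝ (y i) (y j) ≤ 1 / 2)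
    (hs : ∀ i ∈ J, 0.7072 ≤ inner ℝ e (y i)) :
    ∑ i ∈ J, (inner ℝ e (y i) - 0.7072) ≤ 0.3536 ∧
      (J.card + 1 : ℝ) * ∑ i ∈ J, (inner ℝ e (y i) - 0.7072) ^ 2 ≤
        (0.7072 - ∑ i ∈ J, (inner ℝ e (y i) - 0.7072)) ^ 2 := by
  obtain ⟨s, hs'⟩ : ∃ s : ι → ℝ, s = fun i => inner ℝ e (y i) := ⟨_, rfl⟩
  have hse : ∀ i, inner ℝ e (y i) = s i := fun i => by rw [hs']
  have key := sq_sum_weight_mul_inner_le J y e he hy hyy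
  simp only [hse] at hs key ⊢
  obtain ⟨m, hm⟩ : ∃ m : ℝ, m = J.card := ⟨_, rfl⟩
  obtain ⟨T, hT⟩ : ∃ T, T = ∑ i ∈ J, s i := ⟨_, rfl⟩
  obtain ⟨P, hP⟩ : ∃ P, P = ∑ i ∈ J, s i ^ 2 := ⟨_, rfl⟩
  have hm0 : 0 ≤ m := hm ▸ Nat.cast_nonneg _
  have hT0 : 0 ≤ T := hT ▸ Finset.sum_nonneg fun i hi => by linarith [hs i hi]
  have hT2 : T ^ 2 ≤ (m + m ^ 2) / 2 := by
    have := key (fun _ => 1) fun _ _ => zero_le_one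
    simpa [← hT, ← hm] using this
  have hW : ∑ i ∈ J, (s i - 0.7072) = T - m * 0.7072 := by
    rw [Finset.sum_sub_distrib, Finset.sum_const, nsmul_eq_mul, hT, hm]
  have hQ : ∑ i ∈ J, (s i - 0.7072) ^ 2 = P - 2 * 0.7072 * T + m * 0.7072 ^ 2 := by
    simp only [sub_sq, Finset.sum_add_distrib, Finset.sum_sub_distrib, Finset.sum_const,
      nsmul_eq_mul, hT, hP, hm, Finset.mul_sum]
    congr 2
    exact Finset.sum_congr rfl fun i _ => by ring
  -- Take weights `s i - c`. With `c = T / (m + 1)`, their weighted sum and the sum of the two terms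
  -- on the right of `key` both equal `X = P - c * T`, so `X² ≤ X / 2`. The weights are nonnegative
  -- because `c ≤ 0.7072`.
  have hPT : P - T ^ 2 / (m + 1) ≤ 1 / 2 := by
    obtain ⟨c, hc⟩ : ∃ c, c = T / (m + 1) := ⟨_, rfl⟩
    have hcm : c * (m + 1) = T := by rw [hc]; field_simp
    have hc' : c ≤ 0.7072 := by
      rw [hc, div_le_iff₀ (by positivity)]
      nlinarith
    have h := key (fun i => s i - c) fun i hi => by linarith [hs i hi]
    have e1 : ∑ i ∈ J, (s i - c) * s i = P - c * T := by
      rw [hP, hT, Finset.mul_sum, ← Finset.sum_sub_distrib]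
      exact Finset.sum_congr rfl fun i _ => by ring
    have e2 : ∑ i ∈ J, (s i - c) ^ 2 = P - 2 * c * T + m * c ^ 2 := by
      rw [hP, hT, hm, Finset.mul_sum, ← Finset.sum_sub_distrib, ← nsmul_eq_mul,
        ← Finset.sum_const, ← Finset.sum_add_distrib]
      exact Finset.sum_congr rfl fun i _ => by ring
    have e3 : ∑ i ∈ J, (s i - c) = c := by
      rw [Finset.sum_sub_distrib, Finset.sum_const, nsmul_eq_mul, ← hT, ← hm]
      linarith
    rw [e1, e2, e3] at h
    have e4 : P - 2 * c * T + m * c ^ 2 + c ^ 2 = P - c * T := by rw [← hcm]; ring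
    have e5 : T ^ 2 / (m + 1) = c * T := by rw [hc]; ring
    rw [e4] at h
    rw [e5]
    by_contra! hlt
    nlinarith
  refine ⟨?_, ?_⟩
  -- Since `0.7072² > 1/2`, `hT2` gives `T ≤ 0.7072 * (m + 1/2)`.
  · rw [hW]
    by_contra! hlt
    nlinarith
  · rw [hW, hQ, ← hm]
    have h : (m + 1) * P - T ^ 2 ≤ (m + 1) / 2 := by
      have := mul_le_mul_of_nonneg_left hPT (by positivity : 0 ≤ m + 1)
      rw [mul_sub, mul_div_cancel₀ _ (by positivity)] at this
      linarith
    nlinarith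

/-- The two bounds on `Q` cross near `W = 0.25887`. The first is increasing in `W`; the second gives
a convex function of `W`, so only the endpoints matter. -/
theorem quadratic_moment_le {Q W : ℝ} (hW0 : 0 ≤ W) (hW : W ≤ 0.3536) (hQW : Q ≤ W ^ 2)
    (hQ : 3 * Q ≤ (0.7072 - W) ^ 2) : 18.84 * Q + 5.036 * W ≤ 2.56625 := by
  rcases le_total W 0.25887 with h | h
  · nlinarith
  · nlinarith [mul_nonneg (sub_nonneg.2 h) (sub_nonneg.2 hW)]

theorem sum_kissingPolynomial_neg_le {ι V : Type*} [NormedAddCommGroup V] [InnerProductSpace ℝ V]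
    (J : Finset ι) (y : ι → V) (e : V) (he : ‖e‖ = 1) (hy : ∀ i ∈ J, ‖y i‖ = 1)
    (hyy : ∀ i ∈ J, ∀ j ∈ J, i ≠ j → inner ℝ (y i) (y j) ≤ 1 / 2)
    (hey : ∀ i ∈ J, -(1 / 2) ≤ inner ℝ e (y i)) :
    ∑ i ∈ J, kissingPolynomial (-inner ℝ e (y i)) ≤ 2.56625 := by
  classical
  obtain ⟨K, hK⟩ : ∃ K, K = J.filter fun i => 0.7072 ≤ (inner ℝ e (y i) : ℝ) := ⟨_, rfl⟩
  have hKJ : K ⊆ J := hK ▸ Finset.filter_subset _ _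
  have hKs : ∀ i ∈ K, 0.7072 ≤ (inner ℝ e (y i) : ℝ) := fun i hi => by
    rw [hK] at hi
    exact (Finset.mem_filter.1 hi).2
  have hs1 : ∀ i ∈ K, inner ℝ e (y i) ≤ 1 := fun i hi => by
    simpa [he, hy i (hKJ hi)] using real_inner_le_norm e (y i)
  have hle : ∑ i ∈ J, kissingPolynomial (-inner ℝ e (y i)) ≤
      ∑ i ∈ K, kissingPolynomial (-inner ℝ e (y i)) := by
    rw [← Finset.sum_sdiff hKJ]
    refine add_le_of_nonpos_left (Finset.sum_nonpos fun i hi => ?_)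
    obtain ⟨hiJ, hiK⟩ := Finset.mem_sdiff.1 hi
    have : (inner ℝ e (y i) : ℝ) < 0.7072 := by
      by_contra! h
      exact hiK (hK ▸ Finset.mem_filter.2 ⟨hiJ, h⟩)
    exact kissingPolynomial_nonpos (by linarith) (by linarith [hey i hiJ])
  refine hle.trans ?_
  -- A lone point may be so close to `e` that the quadratic majorant exceeds `2.56625`, so it needs
  -- the constant bound. From two points on, `K.card + 1 ≥ 3` supplies the factor in
  -- `quadratic_moment_le`.
  rcases Nat.lt_or_ge K.card 2 with hc | hc
  · rcases Nat.le_one_iff_eq_zero_or_eq_one.1 (Nat.lt_succ_iff.1 hc) with h0 | h1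
    · rw [Finset.card_eq_zero.1 h0, Finset.sum_empty]
      norm_num
    · obtain ⟨i, hi⟩ := Finset.card_eq_one.1 h1
      rw [hi, Finset.sum_singleton]
      have hiK : i ∈ K := hi ▸ Finset.mem_singleton_self i
      exact kissingPolynomial_neg_le_const (hKs i hiK) (hs1 i hiK)
  · obtain ⟨hW, hQ⟩ := moment_bounds K y e he (fun i hi => hy i (hKJ hi))
      (fun i hi j hj => hyy i (hKJ hi) j (hKJ hj)) hKs
    have hu : ∀ i ∈ K, 0 ≤ inner ℝ e (y i) - 0.7072 := fun i hi => sub_nonneg.2 (hKs i hi)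
    have hQ0 : 0 ≤ ∑ i ∈ K, (inner ℝ e (y i) - 0.7072) ^ 2 :=
      Finset.sum_nonneg fun i _ => sq_nonneg _
    have hc' : (2 : ℝ) ≤ K.card := by exact_mod_cast hc
    calc ∑ i ∈ K, kissingPolynomial (-inner ℝ e (y i))
        ≤ ∑ i ∈ K, (18.84 * (inner ℝ e (y i) - 0.7072) ^ 2 + 5.036 * (inner ℝ e (y i) - 0.7072)) :=
          Finset.sum_le_sum fun i hi => kissingPolynomial_neg_le_quadratic (hKs i hi) (hs1 i hi)
      _ = 18.84 * ∑ i ∈ K, (inner ℝ e (y i) - 0.7072) ^ 2 +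
          5.036 * ∑ i ∈ K, (inner ℝ e (y i) - 0.7072) := by
          rw [Finset.sum_add_distrib, Finset.mul_sum, Finset.mul_sum]
      _ ≤ 2.56625 := quadratic_moment_le (Finset.sum_nonneg hu) hW
          (Finset.sum_sq_le_sq_sum_of_nonneg hu) (by nlinarith)

/-! ### The linear programming bound -/

theorem isPSDKernel_kissingPolynomial_sub_one :
    IsPSDKernel fun x y => kissingPolynomial (inner ℝ x y) - 1 := by
  have h := ((((isPSDKernel_inner.const_mul 1.7736 (by norm_num)).add
    (isPSDKernel_legendreP2.const_mul 3.5057 (by norm_num))).add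
    (isPSDKernel_legendreP3.const_mul 1.737 (by norm_num))).add
    (isPSDKernel_legendreP4.const_mul 1.993 (by norm_num))).add
    (isPSDKernel_legendreP9.const_mul 0.4244 (by norm_num))
  refine h.congr fun x y _ _ => ?_
  rw [kissingPolynomial]
  ring

/-- There are no thirteen points on the unit sphere at mutual angles of at least sixty degrees. -/
theorem not_exists_thirteen_unit_vectors (x : Fin 13 → E3) (hx : ∀ i, ‖x i‖ = 1)
    (hxx : ∀ i j, i ≠ j → inner ℝ (x i) (x j) ≤ 1 / 2) : False := by
  have hlow := isPSDKernel_kissingPolynomial_sub_one 13 x hx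
  -- `10.4337 + 2.56625 - 13 = -0.00005`.
  have hrow : ∀ i, ∑ j, (kissingPolynomial (inner ℝ (x i) (x j)) - 1) ≤ -0.00005 := fun i => by
    have h := sum_kissingPolynomial_neg_le (Finset.univ.erase i) x (-x i) (by rw [norm_neg, hx i])
      (fun j _ => hx j) (fun j _ k _ => hxx j k) fun j hj => by
        rw [inner_neg_left]
        exact neg_le_neg (hxx i j (Finset.ne_of_mem_erase hj).symm)
    simp only [inner_neg_left, neg_neg] at h
    have h1 : kissingPolynomial (inner ℝ (x i) (x i)) = 10.4337 := by
      rw [real_inner_self_eq_norm_sq, hx i, one_pow, kissingPolynomial_one]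
    rw [Finset.sum_sub_distrib, ← Finset.add_sum_erase _ _ (Finset.mem_univ i), h1]
    simp only [Finset.sum_const, Finset.card_univ, Fintype.card_fin, nsmul_eq_mul, mul_one]
    norm_num at h ⊢
    linarith
  have hup := hlow.trans (Finset.sum_le_sum fun i _ => hrow i)
  rw [Finset.sum_const, Finset.card_univ, Fintype.card_fin] at hup
  norm_num at hup

/-! ### From spheres to unit vectors -/

theorem unitSpheresTouch_iff (p q : E3) : UnitSpheresTouch p q ↔ dist p q = 2 := by
  rw [UnitSpheresTouch, disjoint_ball_ball_iff one_pos one_pos]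
  constructor
  · rintro ⟨⟨z, hzp, hzq⟩, h⟩
    rw [Metric.mem_sphere] at hzp hzq
    have := dist_triangle_left p q z
    linarith
  · intro h
    have hs : dist (midpoint ℝ p q) p = 1 := by
      rw [dist_midpoint_left, h]
      norm_num
    have ht : dist (midpoint ℝ p q) q = 1 := by
      rw [dist_midpoint_right, h]
      norm_num
    exact ⟨⟨_, hs, ht⟩, by linarith⟩

theorem isKissingConfiguration_iff (o : E3) {n : ℕ} (c : Fin n → E3) :
    IsKissingConfiguration o c ↔
      (∀ i, dist o (c i) = 2) ∧ ∀ i j, i ≠ j → 2 ≤ dist (c i) (c j) := by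
  simp only [IsKissingConfiguration, unitSpheresTouch_iff, Pairwise,
    disjoint_ball_ball_iff one_pos one_pos, one_add_one_eq_two]

theorem not_exists_thirteen_isKissingConfiguration (o : E3) :
    ¬ ∃ c : Fin 13 → E3, IsKissingConfiguration o c := by
  rintro ⟨c, hc⟩
  obtain ⟨ho, hd⟩ := (isKissingConfiguration_iff o c).1 hc
  have hn : ∀ i, ‖c i - o‖ = 2 := fun i => by rw [← dist_eq_norm, dist_comm, ho]
  refine not_exists_thirteen_unit_vectors (fun i => (1 / 2 : ℝ) • (c i - o)) (fun i => ?_)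
    fun i j hij => ?_
  · rw [norm_smul, hn]
    norm_num
  · have h := norm_sub_sq_real (c i - o) (c j - o)
    have h2 := hd i j hij
    rw [dist_eq_norm] at h2
    rw [sub_sub_sub_cancel_right, hn, hn] at h
    rw [real_inner_smul_left, real_inner_smul_right]
    nlinarith

/-! ### The face-centered cubic configuration -/

/-- The twelve shortest nonzero vectors of the face-centered cubic lattice, up to scaling. -/
def fccVector : Fin 12 → Fin 3 → ℤ :=
  ![![1, 1, 0], ![1, -1, 0], ![-1, 1, 0], ![-1, -1, 0],
    ![1, 0, 1], ![1, 0, -1], ![-1, 0, 1], ![-1, 0, -1],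
    ![0, 1, 1], ![0, 1, -1], ![0, -1, 1], ![0, -1, -1]]

theorem sum_sq_fccVector : ∀ i, ∑ k, fccVector i k ^ 2 = 2 := by decide

theorem two_le_sum_sq_fccVector_sub :
    ∀ i j, i ≠ j → 2 ≤ ∑ k, (fccVector i k - fccVector j k) ^ 2 := by decide

theorem exists_twelve_isKissingConfiguration (o : E3) :
    ∃ c : Fin 12 → E3, IsKissingConfiguration o c := by
  have hsq : √(2 : ℝ) ^ 2 = 2 := Real.sq_sqrt zero_le_two
  -- The factor `√2` turns squared length `2` into `4`, that is, distance `2`.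
  refine ⟨fun i => o + √2 • WithLp.toLp 2 fun k => (fccVector i k : ℝ),
    (isKissingConfiguration_iff _ _).2 ⟨fun i => ?_, fun i j hij => ?_⟩⟩
  · have h : (∑ k, (fccVector i k : ℝ) ^ 2) = 2 := by exact_mod_cast sum_sq_fccVector i
    rw [dist_self_add_right, ← sq_eq_sq₀ (norm_nonneg _) zero_le_two, norm_smul, mul_pow,
      EuclideanSpace.real_norm_sq_eq, Real.norm_eq_abs, sq_abs, hsq]
    simp only [h]
    norm_num
  · have h : (2 : ℝ) ≤ ∑ k, ((fccVector i k : ℝ) - fccVector j k) ^ 2 := by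
      exact_mod_cast two_le_sum_sq_fccVector_sub i j hij
    rw [dist_add_left, ← sq_le_sq₀ zero_le_two dist_nonneg, dist_eq_norm, ← smul_sub, norm_smul,
      mul_pow, EuclideanSpace.real_norm_sq_eq, Real.norm_eq_abs, sq_abs, hsq]
    simp only [PiLp.sub_apply]
    linarith

theorem mainTheorem6 (o : E3) :
    (¬ ∃ c : Fin 13 → E3, IsKissingConfiguration o c) ∧
      IsGreatest {n : ℕ | ∃ c : Fin n → E3, IsKissingConfiguration o c} 12 := by
  refine ⟨not_exists_thirteen_isKissingConfiguration o, exists_twelve_isKissingConfiguration o, ?_⟩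
  rintro n ⟨c, hc⟩
  by_contra! hn
  exact not_exists_thirteen_isKissingConfiguration o ⟨fun i => c (Fin.castLE hn i),
    fun i => hc.1 _, fun i j hij => hc.2 fun h => hij (Fin.castLE_injective hn h)⟩
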